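/- For moduli $k,n$ and angle $\varphi$ let $F(\varphi,k)=\int_0^{\varphi}\frac{d\theta}{\sqrt{1-k^2\sin^2\theta}}$, $E(\varphi,k)=\int_0^{\varphi}\sqrt{1-k^2\sin^2\theta}\,d\theta$, $K(k)=F(\pi/2,k)$, $E(k)=E(\pi/2,k)$, $\Pi(n,k)=\int_0^{\pi/2}\frac{d\theta}{(1-n^2\sin^2\theta)\sqrt{1-k^2\sin^2\theta}}$, and let $\operatorname{sign}0=0$. For a point $P=(x,y,z)\in\mathbb R^3$ put $r=\sqrt{x^2+y^2}$, and for $a>0$ put $$p_a^2=(a+r)^2+z^2,\quad q_a^2=(a-r)^2+z^2,\quad k_a^2=\frac{4ar}{p_a^2},\quad k_a'=\sqrt{1-k_a^2},\quad \phi_a=\arcsin\frac{|z|}{q_a}$$ ($p_a,q_a,k_a\ge 0$) and $$W_a(P)=-p_aE(k_a)-\frac{a^2-r^2}{p_a}K(k_a)+|z|\Big(\frac{\pi}{2}+\frac{\pi}{2}\operatorname{sign}(a-r)\Big)-|z|\operatorname{sign}(a-r)\Big(E(k_a)F(\phi_a,k_a')+K(k_a)E(\phi_a,k_a')-K(k_a)F(\phi_a,k_a')\Big).$$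 For a planar body $D$ in the plane $z=0$ with constant surface density $\sigma$ let $U(P)=-G\int_D\frac{\sigma\,dS(Q)}{|PQ|}$ be its Newtonian potential. **Disk.** Let $D=\{x^2+y^2\le a^2\}$, $a>0$, with total mass $M$, so $\sigma=M/(\pi a^2)$. The integral defining $U(P)$ converges for every $P\in\mathbb R^3$. At every $P$ not on the bounding circle ($r=a$, $z=0$), all terms of $W_a(P)$ are well defined (in particular the integrals $K(k_a)$ and $F(\phi_a,k_a')$ converge) and $$U(P)=\frac{2GM}{\pi a^2}\,W_a(P).$$ This includes the points with $r=a$, $z\neq0$, at which $n=1$, where $n^2=4ar/(a+r)^2$, and the integral $\Pi(n,k_a)$ occurring in the closed form with an elliptic integral of the third kind diverges. At a point $P$ of the bounding circle, where $K(k_a)$ and $\phi_a$ are not defined, $U(P)=-\frac{4GM}{\pi a}$, and the formula holds as a limit: $\frac{2GM}{\pi a^2}W_a(P')\to U(P)$ as $P'\to P$ through points off the circle. **Annulus.** Let $D=\{b^2\le x^2+y^2\le a^2\}$, $0<b<a$, with total mass $M$, so $\sigma=M/(\pi(a^2-b^2))$. The integral defining $U(P)$ converges for every $P$; $U$ is the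 difference of the potentials of the disks of radii $a$ and $b$ with this same density $\sigma$; at every $P$ on neither bounding circle $$U(P)=\frac{2GM}{\pi(a^2-b^2)}\big(W_a(P)-W_b(P)\big),$$ and at a point $P$ of a bounding circle the right-hand side, evaluated at points $P'\to P$ off the two circles, tends to $U(P)$. -/

import Mathlib

open MeasureTheory Filter Topology

noncomputable section

namespace DiskPotential

/-- The point `(x, y, 0)` of space that corresponds to the point `Q = (x, y)` of the plane. -/
def planePoint (Q : EuclideanSpace ℝ (Fin 2)) : EuclideanSpace ℝ (Fin 3) :=
  !₂[Q 0, Q 1, 0]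

/-- The closed disk of radius `a` centred at the origin of the `xy`-plane. -/
def disk (a : ℝ) : Set (EuclideanSpace ℝ (Fin 2)) := {Q | ‖Q‖ ≤ a}

/-- The closed annulus of outer radius `a` and inner radius `b` in the `xy`-plane. -/
def annulus (a b : ℝ) : Set (EuclideanSpace ℝ (Fin 2)) := {Q | b ≤ ‖Q‖ ∧ ‖Q‖ ≤ a}

/-- The Newtonian potential `-G ∫_D σ dS / d` at the point `P` of the planar body `D` of constant
surface density `σ`, where `d` is the distance from `P` to the element of mass. -/
def planarPotential (G σ : ℝ) (D : Set (EuclideanSpace ℝ (Fin 2)))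
    (P : EuclideanSpace ℝ (Fin 3)) : ℝ :=
  -G * ∫ Q in D, σ / dist P (planePoint Q)

/-- The integral defining the Newtonian potential of `D` at `P` converges. -/
def PotentialFinite (D : Set (EuclideanSpace ℝ (Fin 2))) (P : EuclideanSpace ℝ (Fin 3)) : Prop :=
  IntegrableOn (fun Q => 1 / dist P (planePoint Q)) D

/-- The potential of the homogeneous disk of radius `a` and total mass `M`. -/
def diskPotential (G M a : ℝ) (P : EuclideanSpace ℝ (Fin 3)) : ℝ :=
  planarPotential G (M / (Real.pi * a ^ 2)) (disk a) P

/-- The potential of the homogeneous annulus of radii `b < a` and total mass `M`. -/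
def annulusPotential (G M a b : ℝ) (P : EuclideanSpace ℝ (Fin 3)) : ℝ :=
  planarPotential G (M / (Real.pi * (a ^ 2 - b ^ 2))) (annulus a b) P

/-- The cylindrical coordinate `r`. -/
def radial (P : EuclideanSpace ℝ (Fin 3)) : ℝ := √(P 0 ^ 2 + P 1 ^ 2)

/-- The cylindrical coordinate `z`. -/
def height (P : EuclideanSpace ℝ (Fin 3)) : ℝ := P 2

/-- The integrand of the integrals of the first kind with modulus `k`. -/
def firstKindIntegrand (k θ : ℝ) : ℝ := 1 / √(1 - k ^ 2 * Real.sin θ ^ 2)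

/-- The integrand of the integrals of the third kind. -/
def thirdKindIntegrand (n k θ : ℝ) : ℝ :=
  1 / ((1 - n ^ 2 * Real.sin θ ^ 2) * √(1 - k ^ 2 * Real.sin θ ^ 2))

/-- Incomplete elliptic integral of the first kind `F(φ, k)`. -/
def ellipticF (φ k : ℝ) : ℝ := ∫ θ in (0 : ℝ)..φ, firstKindIntegrand k θ

/-- Incomplete elliptic integral of the second kind `E(φ, k)`. -/
def ellipticEInc (φ k : ℝ) : ℝ := ∫ θ in (0 : ℝ)..φ, √(1 - k ^ 2 * Real.sin θ ^ 2)

/-- Complete elliptic integral of the first kind `K(k)`. -/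
def ellipticK (k : ℝ) : ℝ := ellipticF (Real.pi / 2) k

/-- Complete elliptic integral of the second kind `E(k)`. -/
def ellipticE (k : ℝ) : ℝ := ellipticEInc (Real.pi / 2) k

/-- The longest distance `p` from the point `(r, z)` to the circle of radius `a`. -/
def pDist (a r z : ℝ) : ℝ := √((a + r) ^ 2 + z ^ 2)

/-- The shortest distance `q` from the point `(r, z)` to the circle of radius `a`. -/
def qDist (a r z : ℝ) : ℝ := √((a - r) ^ 2 + z ^ 2)

/-- The modulus `k`, with `k² = 4ar / p²`. -/
def modulus (a r z : ℝ) : ℝ := √(4 * a * r / ((a + r) ^ 2 + z ^ 2))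

/-- The complementary modulus `k' = √(1 - k²)`. -/
def coModulus (a r z : ℝ) : ℝ := √(1 - modulus a r z ^ 2)

/-- The parameter `n` of the integral of the third kind, with `n² = 4ar / (a + r)²`. -/
def thirdKindParam (a r : ℝ) : ℝ := √(4 * a * r / (a + r) ^ 2)

/-- The angle `φ = arcsin (|z| / q)`. -/
def amplitude (a r z : ℝ) : ℝ := Real.arcsin (|z| / qDist a r z)

/-- The closed form, without the factor `2GM / (πa²)`. -/
def closedForm (a r z : ℝ) : ℝ :=
  let p := pDist a r z
  let k := modulus a r z
  let k' := coModulus a r z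
  let φ := amplitude a r z;
  -p * ellipticE k - (a ^ 2 - r ^ 2) / p * ellipticK k
    + |z| * (Real.pi / 2 + Real.pi / 2 * Real.sign (a - r))
    - |z| * Real.sign (a - r) *
      (ellipticE k * ellipticF φ k' + ellipticK k * ellipticEInc φ k'
        - ellipticK k * ellipticF φ k')

/-- Every term of the closed form is well defined: the divisors `p` and `q` are positive, the
arcsine is taken of a number in `[0, 1]`, the moduli are in `[0, 1]`, and the integrals that define
`K(k)` and `F(φ, k')` converge (those that define `E(k)` and `E(φ, k')` always do). -/
structure ClosedFormDefined (a r z : ℝ) : Prop where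
  p_pos : 0 < pDist a r z
  q_pos : 0 < qDist a r z
  ratio_le : |z| / qDist a r z ≤ 1
  arg_le : 4 * a * r / ((a + r) ^ 2 + z ^ 2) ≤ 1
  arg_nonneg : 0 ≤ 4 * a * r / ((a + r) ^ 2 + z ^ 2)
  integrable_K :
    IntervalIntegrable (firstKindIntegrand (modulus a r z)) volume 0 (Real.pi / 2)
  integrable_F :
    IntervalIntegrable (firstKindIntegrand (coModulus a r z)) volume 0 (amplitude a r z)

/-- The circle of radius `a` around the origin in the plane `z = 0`. -/
def rim (a : ℝ) : Set (EuclideanSpace ℝ (Fin 3)) := {P | radial P = a ∧ height P = 0}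

end DiskPotential

end

open DiskPotential

/-! Everything reduces to `diskIntegral`, the integral of 1/d over the disk, which has to equal -2 W
off the bounding circle and 4a on it.

Let u be the vector from the projection of P to a point of the plane, and s = √(|u|² + z²). The
plane field u/(s + |z|) has divergence 1/s and, for z ≠ 0, no singularity, so the divergence theorem
turns the potential into an integral over the bounding circle (`integral_polar_eq`,
`diskIntegral_eq_rim`). The half-angle substitution makes this `halfAngleIntegral`. For r ≠ a its
integrand splits into first, second and third kind terms and an elementary one
(`halfAngle_integrand_split`); for r = a the last two are absent.

The third kind term is Heuman's combination of E, F and K. To see this, a sphero-conal area is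
computed twice: its element separates into products of one-variable functions, which gives the
combination, and it is also the divergence of an explicit field, which gives one boundary integral
(`heuman_eq`, `heuman_eq_thirdKind`). The elementary term produces the π/2 sign(a - r) summand.

The potential is continuous on all of space (`continuous_diskIntegral`). This supplies the points
with z = 0 in the boundary formula, and all the limits at bounding circles. An annulus is a
difference of disks up to a null set. -/

namespace DiskPotential

/-! ### A divergence identity and Heuman's combination of elliptic integrals -/

/-- The divergence theorem on a rectangle for a vector field `(A, B)` whose flux through the two
sides parallel to the first axis cancels. -/
lemma integral_divergence_rectangle {A A' B B' : ℝ → ℝ → ℝ} {t₀ t₁ x₀ x₁ : ℝ}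
    (hA : ∀ t ∈ Set.uIcc t₀ t₁, ∀ x ∈ Set.uIcc x₀ x₁, HasDerivAt (fun t => A t x) (A' t x) t)
    (hB : ∀ t ∈ Set.uIcc t₀ t₁, ∀ x ∈ Set.uIcc x₀ x₁, HasDerivAt (B t) (B' t x) x)
    (hA' : ContinuousOn (Function.uncurry A') (Set.uIcc t₀ t₁ ×ˢ Set.uIcc x₀ x₁))
    (hB' : ContinuousOn (Function.uncurry B') (Set.uIcc t₀ t₁ ×ˢ Set.uIcc x₀ x₁))
    (hper : ∀ t ∈ Set.uIcc t₀ t₁, B t x₁ = B t x₀) :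
    ∫ t in t₀..t₁, ∫ x in x₀..x₁, (A' t x + B' t x) = ∫ x in x₀..x₁, (A t₁ x - A t₀ x) := by
  have h1 : ∀ t ∈ Set.uIcc t₀ t₁,
      ∫ x in x₀..x₁, (A' t x + B' t x) = ∫ x in x₀..x₁, A' t x := by
    intro t ht
    have cA : ContinuousOn (A' t) (Set.uIcc x₀ x₁) :=
      hA'.comp (f := fun x => (t, x)) (by fun_prop) (fun x hx => ⟨ht, hx⟩)
    have cB : ContinuousOn (B' t) (Set.uIcc x₀ x₁) :=
      hB'.comp (f := fun x => (t, x)) (by fun_prop) (fun x hx => ⟨ht, hx⟩)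
    rw [intervalIntegral.integral_add cA.intervalIntegrable cB.intervalIntegrable,
      intervalIntegral.integral_eq_sub_of_hasDerivAt (hB t ht) cB.intervalIntegrable, hper t ht]
    simp
  rw [intervalIntegral.integral_congr h1, intervalIntegral_intervalIntegral_swap
    ((hA'.integrableOn_compact (isCompact_uIcc.prod isCompact_uIcc)).mono_set
      (Set.prod_mono Set.uIoc_subset_uIcc Set.uIoc_subset_uIcc))]
  refine intervalIntegral.integral_congr fun x hx => ?_
  have cA : ContinuousOn (fun t => A' t x) (Set.uIcc t₀ t₁) :=
    hA'.comp (f := fun t => (t, x)) (by fun_prop) (fun t ht => ⟨ht, hx⟩)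
  exact intervalIntegral.integral_eq_sub_of_hasDerivAt (fun t ht => hA t ht x hx)
    cA.intervalIntegrable

/-- The derivative of the kernel that relates the sphero-conal area element to the integral of the
third kind. -/
noncomputable def kernelDeriv (n e δ t : ℝ) : ℝ :=
  (n * ((1 - 2 * Real.sin t ^ 2) * (1 - n * Real.sin t ^ 2)
      - n * Real.sin t ^ 2 * (1 - Real.sin t ^ 2)) * (1 - n * Real.sin t ^ 2 - e)
    + 2 * n ^ 2 * Real.sin t ^ 2 * (1 - Real.sin t ^ 2) * (1 - n * Real.sin t ^ 2)) /
    ((1 - n * Real.sin t ^ 2 - e) ^ 2 * √(1 - n * Real.sin t ^ 2) * δ)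

lemma hasDerivAt_kernel {n e δ t : ℝ} (hσ : 0 < 1 - n * Real.sin t ^ 2)
    (hD : 1 - n * Real.sin t ^ 2 - e ≠ 0) (hδ : δ ≠ 0) :
    HasDerivAt (fun t => n * Real.sin t * Real.cos t * √(1 - n * Real.sin t ^ 2) /
      ((1 - n * Real.sin t ^ 2 - e) * δ)) (kernelDeriv n e δ t) t := by
  have hs := Real.hasDerivAt_sin t
  have hc := Real.hasDerivAt_cos t
  have hq : HasDerivAt (fun t => 1 - n * Real.sin t ^ 2)
      (-(n * (2 * Real.sin t * Real.cos t))) t := by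
    have := ((hs.pow 2).const_mul n).const_sub 1
    simpa using this
  have hσ' := hq.sqrt hσ.ne'
  have hN := ((hs.const_mul n).mul hc).mul hσ'
  have := hN.div ((hq.sub_const e).mul_const δ) (mul_ne_zero hD hδ)
  refine this.congr_deriv ?_
  have hσ0 : √(1 - n * Real.sin t ^ 2) ≠ 0 := (Real.sqrt_pos.2 hσ).ne'
  have hσ2 : √(1 - n * Real.sin t ^ 2) ^ 2 = 1 - n * Real.sin t ^ 2 := Real.sq_sqrt hσ.le
  have hc2 : Real.cos t ^ 2 = 1 - Real.sin t ^ 2 := by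
    rw [← Real.sin_sq_add_cos_sq t]; ring
  simp only [kernelDeriv, Pi.mul_apply]
  generalize √(1 - n * Real.sin t ^ 2) = σ at *
  generalize Real.sin t = s at *
  generalize Real.cos t = c at *
  generalize hDD : 1 - n * s ^ 2 - e = D at *
  field_simp
  rw [hσ2, hc2]
  ring

/-- Exchanging m with 1 - m and t with x preserves the common factor D in the denominators. The sum
of the two derivatives is then the divergence of the field used in `integral_area_eq`, and the
powers of D in the denominator cancel. -/
lemma kernelDeriv_add {m t x : ℝ} (hσ : 0 < 1 - (1 - m) * Real.sin t ^ 2)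
    (hδ : 0 < 1 - m * Real.sin x ^ 2)
    (hD : 1 - (1 - m) * Real.sin t ^ 2 - m * Real.sin x ^ 2 ≠ 0) :
    kernelDeriv (1 - m) (m * Real.sin x ^ 2) (√(1 - m * Real.sin x ^ 2)) t +
      kernelDeriv m ((1 - m) * Real.sin t ^ 2) (√(1 - (1 - m) * Real.sin t ^ 2)) x =
    (1 - (1 - m) * Real.sin t ^ 2 - m * Real.sin x ^ 2) /
      (√(1 - m * Real.sin x ^ 2) * √(1 - (1 - m) * Real.sin t ^ 2)) := by
  have h1 := (Real.sqrt_pos.2 hσ).ne'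
  have h2 := (Real.sqrt_pos.2 hδ).ne'
  have e1 : 1 - m * Real.sin x ^ 2 - (1 - m) * Real.sin t ^ 2 =
    1 - (1 - m) * Real.sin t ^ 2 - m * Real.sin x ^ 2 := by ring
  unfold kernelDeriv
  rw [e1]
  generalize √(1 - m * Real.sin x ^ 2) = δ at *
  generalize √(1 - (1 - m) * Real.sin t ^ 2) = σ at *
  generalize Real.sin t = s at *
  generalize Real.sin x = S at *
  generalize hDD : 1 - (1 - m) * s ^ 2 - m * S ^ 2 = D at *
  field_simp
  rw [← hDD]
  ring

lemma one_sub_mul_sin_sq_pos {m x : ℝ} (h1 : m < 1) : 0 < 1 - m * Real.sin x ^ 2 := by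
  rcases le_total m 0 with h | h
  · nlinarith [sq_nonneg (Real.sin x)]
  · nlinarith [Real.sin_sq_le_one x]

lemma one_sub_mul_sin_sq_pos' {m t : ℝ} (h0 : 0 ≤ m) (ht : 0 < Real.cos t) :
    0 < 1 - (1 - m) * Real.sin t ^ 2 := by
  nlinarith [Real.sin_sq_add_cos_sq t, mul_nonneg h0 (sq_nonneg (Real.sin t)), pow_pos ht 2]

/-- Written with cosines, the expression can vanish only where cos t = 0; this is why φ < π/2 is
assumed below. -/
lemma area_numerator_pos {m t : ℝ} (h0 : 0 ≤ m) (h1 : m < 1) (ht : 0 < Real.cos t) (x : ℝ) :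
    0 < 1 - (1 - m) * Real.sin t ^ 2 - m * Real.sin x ^ 2 := by
  have e : 1 - (1 - m) * Real.sin t ^ 2 - m * Real.sin x ^ 2 =
      (1 - m) * Real.cos t ^ 2 + m * Real.cos x ^ 2 := by
    rw [Real.cos_sq', Real.cos_sq']; ring
  rw [e]
  have := mul_pos (sub_pos.2 h1) (pow_pos ht 2)
  positivity

/-- The sphero-conal area of a coordinate sector in terms of an integral of the third kind. -/
lemma integral_area_eq {m φ : ℝ} (h0 : 0 ≤ m) (h1 : m < 1) (hφ0 : 0 ≤ φ)
    (hφ : φ < Real.pi / 2) :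
    ∫ t in (0 : ℝ)..φ, ∫ x in (0 : ℝ)..(Real.pi / 2),
      (1 - (1 - m) * Real.sin t ^ 2 - m * Real.sin x ^ 2) /
        (√(1 - m * Real.sin x ^ 2) * √(1 - (1 - m) * Real.sin t ^ 2)) =
    ∫ x in (0 : ℝ)..(Real.pi / 2),
      (1 - m) * Real.sin φ * Real.cos φ * √(1 - (1 - m) * Real.sin φ ^ 2) /
        ((1 - (1 - m) * Real.sin φ ^ 2 - m * Real.sin x ^ 2) * √(1 - m * Real.sin x ^ 2)) := by
  have hcos : ∀ t ∈ Set.uIcc 0 φ, 0 < Real.cos t := by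
    intro t ht
    rw [Set.uIcc_of_le hφ0] at ht
    exact Real.cos_pos_of_mem_Ioo ⟨by linarith [ht.1, Real.pi_pos], by linarith [ht.2]⟩
  have key := integral_divergence_rectangle (t₀ := 0) (t₁ := φ) (x₀ := 0) (x₁ := Real.pi / 2)
    (A := fun t x => (1 - m) * Real.sin t * Real.cos t * √(1 - (1 - m) * Real.sin t ^ 2) /
        ((1 - (1 - m) * Real.sin t ^ 2 - m * Real.sin x ^ 2) * √(1 - m * Real.sin x ^ 2)))
    (A' := fun t x => kernelDeriv (1 - m) (m * Real.sin x ^ 2) (√(1 - m * Real.sin x ^ 2)) t)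
    (B := fun t x => m * Real.sin x * Real.cos x * √(1 - m * Real.sin x ^ 2) /
        ((1 - m * Real.sin x ^ 2 - (1 - m) * Real.sin t ^ 2) * √(1 - (1 - m) * Real.sin t ^ 2)))
    (B' := fun t x =>
      kernelDeriv m ((1 - m) * Real.sin t ^ 2) (√(1 - (1 - m) * Real.sin t ^ 2)) x)
    ?_ ?_ ?_ ?_ ?_
  -- The flux through t = 0 vanishes because of the factor sin t, so only the side t = φ
  -- contributes.
  · simp only [Real.sin_zero, mul_zero, zero_mul, zero_div, sub_zero] at key
    rw [← key]
    refine intervalIntegral.integral_congr fun t ht => ?_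
    refine intervalIntegral.integral_congr fun x _ => ?_
    exact (kernelDeriv_add (one_sub_mul_sin_sq_pos' h0 (hcos t ht)) (one_sub_mul_sin_sq_pos h1)
      (area_numerator_pos h0 h1 (hcos t ht) x).ne').symm
  · intro t ht x _
    exact hasDerivAt_kernel (one_sub_mul_sin_sq_pos' h0 (hcos t ht))
      (area_numerator_pos h0 h1 (hcos t ht) x).ne'
      (Real.sqrt_pos.2 (one_sub_mul_sin_sq_pos h1)).ne'
  · intro t ht x _
    refine hasDerivAt_kernel (one_sub_mul_sin_sq_pos h1) ?_
      (Real.sqrt_pos.2 (one_sub_mul_sin_sq_pos' h0 (hcos t ht))).ne'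
    have := area_numerator_pos h0 h1 (hcos t ht) x
    intro h
    linarith
  · unfold kernelDeriv Function.uncurry
    refine ContinuousOn.div (by fun_prop) (by fun_prop) ?_
    rintro ⟨t, x⟩ ⟨ht, _⟩
    have h2 := area_numerator_pos h0 h1 (hcos t ht) x
    have h3 := Real.sqrt_pos.2 (one_sub_mul_sin_sq_pos' h0 (hcos t ht))
    have h4 := Real.sqrt_pos.2 (one_sub_mul_sin_sq_pos (m := m) (x := x) h1)
    exact (mul_pos (mul_pos (pow_pos h2 2) h3) h4).ne'
  · unfold kernelDeriv Function.uncurry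
    refine ContinuousOn.div (by fun_prop) (by fun_prop) ?_
    rintro ⟨t, x⟩ ⟨ht, _⟩
    have h2 : 0 < 1 - m * Real.sin x ^ 2 - (1 - m) * Real.sin t ^ 2 := by
      linarith [area_numerator_pos h0 h1 (hcos t ht) x]
    have h3 := Real.sqrt_pos.2 (one_sub_mul_sin_sq_pos' h0 (hcos t ht))
    have h4 := Real.sqrt_pos.2 (one_sub_mul_sin_sq_pos (m := m) (x := x) h1)
    exact (mul_pos (mul_pos (pow_pos h2 2) h4) h3).ne'
  -- The factor sin x cos x kills the flux through both x = 0 and x = π/2.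
  · intro t _
    simp

/-- Heuman's combination of elliptic integrals as an integral of the third kind. -/
lemma heuman_eq {k k' φ : ℝ} (hk' : k' ^ 2 = 1 - k ^ 2) (h1 : k ^ 2 < 1) (hφ0 : 0 ≤ φ)
    (hφ : φ < Real.pi / 2) :
    ellipticE k * ellipticF φ k' + ellipticK k * ellipticEInc φ k' - ellipticK k * ellipticF φ k' =
      (1 - k ^ 2) * Real.sin φ * Real.cos φ * √(1 - (1 - k ^ 2) * Real.sin φ ^ 2) *
      ∫ x in (0 : ℝ)..(Real.pi / 2),
        1 / ((1 - (1 - k ^ 2) * Real.sin φ ^ 2 - k ^ 2 * Real.sin x ^ 2) *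
          √(1 - k ^ 2 * Real.sin x ^ 2)) := by
  have key := integral_area_eq (sq_nonneg k) h1 hφ0 hφ
  have hcos : ∀ t ∈ Set.uIcc 0 φ, 0 < Real.cos t := by
    intro t ht
    rw [Set.uIcc_of_le hφ0] at ht
    exact Real.cos_pos_of_mem_Ioo ⟨by linarith [ht.1, Real.pi_pos], by linarith [ht.2]⟩
  have hpos : ∀ x : ℝ, 0 < √(1 - k ^ 2 * Real.sin x ^ 2) := fun x =>
    Real.sqrt_pos.2 (one_sub_mul_sin_sq_pos h1)
  have hpos' : ∀ t ∈ Set.uIcc 0 φ, 0 < √(1 - (1 - k ^ 2) * Real.sin t ^ 2) := fun t ht =>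
    Real.sqrt_pos.2 (one_sub_mul_sin_sq_pos' (sq_nonneg k) (hcos t ht))
  rw [← intervalIntegral.integral_const_mul]
  simp only [mul_one_div]
  rw [← key]
  have c1 : Continuous fun x : ℝ => 1 / √(1 - k ^ 2 * Real.sin x ^ 2) :=
    continuous_const.div (by fun_prop) fun x => (hpos x).ne'
  have c2 : Continuous fun x : ℝ => √(1 - k ^ 2 * Real.sin x ^ 2) := by fun_prop
  have c3 : ContinuousOn (fun t : ℝ => 1 / √(1 - (1 - k ^ 2) * Real.sin t ^ 2)) (Set.uIcc 0 φ) :=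
    continuousOn_const.div (by fun_prop) fun x hx => (hpos' x hx).ne'
  have c4 : Continuous fun t : ℝ => √(1 - (1 - k ^ 2) * Real.sin t ^ 2) := by fun_prop
  have inner : ∀ t ∈ Set.uIcc 0 φ, ∫ x in (0 : ℝ)..(Real.pi / 2),
      (1 - (1 - k ^ 2) * Real.sin t ^ 2 - k ^ 2 * Real.sin x ^ 2) /
        (√(1 - k ^ 2 * Real.sin x ^ 2) * √(1 - (1 - k ^ 2) * Real.sin t ^ 2)) =
      (ellipticE k - ellipticK k) * (1 / √(1 - (1 - k ^ 2) * Real.sin t ^ 2)) +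
        ellipticK k * √(1 - (1 - k ^ 2) * Real.sin t ^ 2) := by
    intro t ht
    have hσ := hpos' t ht
    have hσ2 : √(1 - (1 - k ^ 2) * Real.sin t ^ 2) ^ 2 = 1 - (1 - k ^ 2) * Real.sin t ^ 2 :=
      Real.sq_sqrt (one_sub_mul_sin_sq_pos' (sq_nonneg k) (hcos t ht)).le
    set σ := √(1 - (1 - k ^ 2) * Real.sin t ^ 2) with hσdef
    -- With δ the square root in x, the numerator is σ² + δ² - 1, so the area element separates into
    -- products of functions of t and of x.
    have e : ∀ x ∈ Set.uIcc 0 (Real.pi / 2),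
        (1 - (1 - k ^ 2) * Real.sin t ^ 2 - k ^ 2 * Real.sin x ^ 2) /
          (√(1 - k ^ 2 * Real.sin x ^ 2) * σ) =
        1 / σ * √(1 - k ^ 2 * Real.sin x ^ 2) +
          (σ - 1 / σ) * (1 / √(1 - k ^ 2 * Real.sin x ^ 2)) := by
      intro x _
      have hδ := hpos x
      have hδ2 : √(1 - k ^ 2 * Real.sin x ^ 2) ^ 2 = 1 - k ^ 2 * Real.sin x ^ 2 :=
        Real.sq_sqrt (one_sub_mul_sin_sq_pos h1).le
      generalize √(1 - k ^ 2 * Real.sin x ^ 2) = δ at *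
      field_simp
      linear_combination -hσ2 - hδ2
    rw [intervalIntegral.integral_congr e, intervalIntegral.integral_add
      ((c2.intervalIntegrable _ _).const_mul _) ((c1.intervalIntegrable _ _).const_mul _),
      intervalIntegral.integral_const_mul, intervalIntegral.integral_const_mul]
    simp only [ellipticE, ellipticEInc, ellipticK, ellipticF, firstKindIntegrand]
    ring
  rw [intervalIntegral.integral_congr inner, intervalIntegral.integral_add
    (c3.intervalIntegrable.const_mul _) ((c4.intervalIntegrable _ _).const_mul _),
    intervalIntegral.integral_const_mul, intervalIntegral.integral_const_mul]
  simp only [ellipticF, ellipticEInc, firstKindIntegrand, hk']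
  ring

/-! ### Convergence and continuity of the disk potential -/

/-- The orthogonal projection to the plane `z = 0`. -/
noncomputable def projPlane (P : EuclideanSpace ℝ (Fin 3)) : EuclideanSpace ℝ (Fin 2) :=
  !₂[P 0, P 1]

lemma continuous_projPlane : Continuous projPlane := by
  unfold projPlane
  refine (PiLp.continuous_toLp 2 _).comp (continuous_pi fun i => ?_)
  fin_cases i <;> simp <;> fun_prop

lemma dist_planePoint (P : EuclideanSpace ℝ (Fin 3)) (Q : EuclideanSpace ℝ (Fin 2)) :
    dist P (planePoint Q) = √((P 0 - Q 0) ^ 2 + (P 1 - Q 1) ^ 2 + P 2 ^ 2) := by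
  rw [EuclideanSpace.dist_eq, Fin.sum_univ_three]
  simp [planePoint, Real.dist_eq, sq_abs]

lemma dist_planePoint_add (P : EuclideanSpace ℝ (Fin 3)) (u : EuclideanSpace ℝ (Fin 2)) :
    dist P (planePoint (u + projPlane P)) = √(‖u‖ ^ 2 + P 2 ^ 2) := by
  rw [dist_planePoint, EuclideanSpace.real_norm_sq_eq, Fin.sum_univ_two]
  simp [projPlane]

lemma isClosed_disk (a : ℝ) : IsClosed (disk a) := isClosed_le continuous_norm continuous_const

/-- The integral `∫ dS / d` over the disk of radius `a`. -/
noncomputable def diskIntegral (a : ℝ) (P : EuclideanSpace ℝ (Fin 3)) : ℝ :=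
  ∫ Q in disk a, 1 / dist P (planePoint Q)

/-- The integrand of `diskIntegral` in the coordinates centred at the projection of `P`. -/
noncomputable def shiftedIntegrand (a : ℝ) (P : EuclideanSpace ℝ (Fin 3))
    (u : EuclideanSpace ℝ (Fin 2)) : ℝ :=
  (disk a).indicator (fun _ => 1 / √(‖u‖ ^ 2 + P 2 ^ 2)) (u + projPlane P)

lemma shiftedIntegrand_eq (a : ℝ) (P : EuclideanSpace ℝ (Fin 3)) (u : EuclideanSpace ℝ (Fin 2)) :
    shiftedIntegrand a P u =
      (disk a).indicator (fun Q => 1 / dist P (planePoint Q)) (u + projPlane P) := by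
  simp only [shiftedIntegrand, Set.indicator, dist_planePoint_add]

lemma diskIntegral_eq_shifted (a : ℝ) (P : EuclideanSpace ℝ (Fin 3)) :
    diskIntegral a P = ∫ u, shiftedIntegrand a P u := by
  simp_rw [shiftedIntegrand_eq]
  rw [integral_add_right_eq_self (fun Q => (disk a).indicator _ Q),
    integral_indicator (isClosed_disk a).measurableSet]
  rfl

/-- A bound for `shiftedIntegrand`. -/
noncomputable def shiftedBound (R : ℝ) (u : EuclideanSpace ℝ (Fin 2)) : ℝ :=
  (Metric.ball (0 : EuclideanSpace ℝ (Fin 2)) R).indicator (fun u => 1 / ‖u‖) u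

/-- In dimension two the Jacobian of polar coordinates cancels the singularity 1/‖u‖. -/
lemma integrable_shiftedBound (R : ℝ) : Integrable (shiftedBound R) := by
  refine IntegrableOn.integrable_indicator ?_ measurableSet_ball
  rw [integrableOn_fun_norm_addHaar volume (f := fun y => 1 / y)]
  refine (integrableOn_congr_fun (g := fun _ => (1 : ℝ)) ?_ measurableSet_Ioo).2 ?_
  · intro y hy
    have : y ≠ 0 := hy.1.ne'
    simp [this]
  · simp

lemma norm_shiftedIntegrand_le {a R : ℝ} {P : EuclideanSpace ℝ (Fin 3)}
    (hP : a + ‖projPlane P‖ < R) {u : EuclideanSpace ℝ (Fin 2)} (hu : u ≠ 0) :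
    ‖shiftedIntegrand a P u‖ ≤ shiftedBound R u := by
  have hpos : 0 < ‖u‖ := norm_pos_iff.2 hu
  unfold shiftedIntegrand
  by_cases h : u + projPlane P ∈ disk a
  · have hball : u ∈ Metric.ball (0 : EuclideanSpace ℝ (Fin 2)) R := by
      rw [mem_ball_zero_iff]
      have h1 : ‖u‖ ≤ ‖u + projPlane P‖ + ‖projPlane P‖ := by
        simpa using norm_sub_le (u + projPlane P) (projPlane P)
      have h2 : ‖u + projPlane P‖ ≤ a := h
      linarith
    rw [Set.indicator_of_mem h, shiftedBound, Set.indicator_of_mem hball, Real.norm_eq_abs,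
      abs_of_nonneg (by positivity)]
    exact one_div_le_one_div_of_le hpos (Real.le_sqrt_of_sq_le (by nlinarith [sq_nonneg (P 2)]))
  · rw [Set.indicator_of_notMem h, norm_zero]
    exact Set.indicator_nonneg (fun _ _ => by positivity) _

lemma aestronglyMeasurable_shiftedIntegrand (a : ℝ) (P : EuclideanSpace ℝ (Fin 3)) :
    AEStronglyMeasurable (shiftedIntegrand a P) volume := by
  have hm : Measurable ((disk a).indicator fun Q => 1 / dist P (planePoint Q)) := by
    refine Measurable.indicator ?_ (isClosed_disk a).measurableSet
    simp_rw [dist_planePoint]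
    fun_prop
  have : shiftedIntegrand a P = ((disk a).indicator fun Q => 1 / dist P (planePoint Q)) ∘
      (fun u => u + projPlane P) := funext fun u => shiftedIntegrand_eq a P u
  rw [this]
  exact (hm.comp (measurable_id.add_const _)).aestronglyMeasurable

lemma ae_ne_zero : ∀ᵐ u : EuclideanSpace ℝ (Fin 2), u ≠ 0 := by
  simp [ae_iff]

lemma integrable_shiftedIntegrand (a : ℝ) (P : EuclideanSpace ℝ (Fin 3)) :
    Integrable (shiftedIntegrand a P) :=
  (integrable_shiftedBound (a + ‖projPlane P‖ + 1)).mono'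
    (aestronglyMeasurable_shiftedIntegrand a P)
    (ae_ne_zero.mono fun _ hu => norm_shiftedIntegrand_le (by linarith) hu)

lemma potentialFinite_disk (a : ℝ) (P : EuclideanSpace ℝ (Fin 3)) : PotentialFinite (disk a) P := by
  unfold PotentialFinite
  rw [← integrable_indicator_iff (isClosed_disk a).measurableSet]
  have h := (integrable_shiftedIntegrand a P).comp_sub_right (projPlane P)
  refine h.congr (Eventually.of_forall fun Q => ?_)
  simp [shiftedIntegrand_eq]

/-- After the shift the singularity stays at u = 0 while the disk moves with P. Continuity in P can
fail only at u = 0 or where u lies on the moved circle, a null set, so dominated convergence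
applies. -/
lemma continuousAt_shiftedIntegrand {a : ℝ} {P : EuclideanSpace ℝ (Fin 3)}
    {u : EuclideanSpace ℝ (Fin 2)} (hu : u ≠ 0) (h : ‖u + projPlane P‖ ≠ a) :
    ContinuousAt (fun P => shiftedIntegrand a P u) P := by
  have hc : Continuous fun P => ‖u + projPlane P‖ :=
    (continuous_const.add continuous_projPlane).norm
  rcases lt_or_gt_of_ne h with h | h
  · have hcont : ContinuousAt (fun P : EuclideanSpace ℝ (Fin 3) => 1 / √(‖u‖ ^ 2 + P 2 ^ 2)) P := by
      refine ContinuousAt.div (by fun_prop) (by fun_prop) ?_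
      have := norm_pos_iff.2 hu
      positivity
    refine hcont.congr ?_
    filter_upwards [hc.continuousAt.eventually_lt continuousAt_const h] with P' hP'
    have h0 : u + projPlane P' ∈ disk a := hP'.le
    simp [shiftedIntegrand, h0]
  · refine (continuousAt_const (X := EuclideanSpace ℝ (Fin 3)) (y := (0 : ℝ))).congr ?_
    filter_upwards [continuousAt_const.eventually_lt hc.continuousAt h] with P' hP'
    have h0 : u + projPlane P' ∉ disk a := not_le.2 hP'
    simp [shiftedIntegrand, h0]

/-- The potential of a homogeneous disk is continuous. -/
lemma continuous_diskIntegral (a : ℝ) : Continuous (diskIntegral a) := by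
  rw [continuous_iff_continuousAt]
  intro P
  rw [funext (diskIntegral_eq_shifted a)]
  refine continuousAt_of_dominated (bound := shiftedBound (a + ‖projPlane P‖ + 1))
    (Eventually.of_forall fun P' => aestronglyMeasurable_shiftedIntegrand a P') ?_
    (integrable_shiftedBound _) ?_
  · have : ∀ᶠ P' in 𝓝 P, ‖projPlane P'‖ < ‖projPlane P‖ + 1 :=
      continuous_projPlane.norm.continuousAt.eventually_lt continuousAt_const (by simp)
    filter_upwards [this] with P' hP'
    exact ae_ne_zero.mono fun _ hu => norm_shiftedIntegrand_le (by linarith) hu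
  · have hs : ∀ᵐ u : EuclideanSpace ℝ (Fin 2), u ∉ Metric.sphere (-projPlane P) a :=
      compl_mem_ae_iff.2 (Measure.addHaar_sphere _ _ _)
    filter_upwards [ae_ne_zero, hs] with u hu hu'
    refine continuousAt_shiftedIntegrand hu ?_
    simpa [dist_eq_norm] using hu'

/-! ### Reduction to an integral over the bounding circle -/

lemma integral_euclidean_two (f : ℝ × ℝ → ℝ) :
    ∫ Q : EuclideanSpace ℝ (Fin 2), f (Q 0, Q 1) = ∫ p, f p := by
  rw [← (volume_preserving_finTwoArrow ℝ).integral_comp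
    MeasurableEquiv.finTwoArrow.measurableEmbedding,
    ← (EuclideanSpace.volume_preserving_symm_measurableEquiv_toLp (Fin 2)).integral_comp
    (MeasurableEquiv.measurableEmbedding _)]
  rfl

/-- The squared distance from a point at distance `r` from the axis and at height `z` to the point
of polar coordinates `(ρ, ϑ)` of the plane. -/
noncomputable def sqDist (r z ρ ϑ : ℝ) : ℝ := ρ ^ 2 + r ^ 2 - 2 * ρ * r * Real.cos ϑ + z ^ 2

lemma sqDist_eq (r z ρ ϑ : ℝ) :
    sqDist r z ρ ϑ = (ρ - r * Real.cos ϑ) ^ 2 + (r * Real.sin ϑ) ^ 2 + z ^ 2 := by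
  unfold sqDist
  linear_combination (- r ^ 2) * Real.sin_sq_add_cos_sq ϑ

lemma sqDist_nonneg (r z ρ ϑ : ℝ) : 0 ≤ sqDist r z ρ ϑ := by
  rw [sqDist_eq]; positivity

lemma sqDist_pos {z : ℝ} (hz : z ≠ 0) (r ρ ϑ : ℝ) : 0 < sqDist r z ρ ϑ := by
  rw [sqDist_eq]; positivity

lemma hasDerivAt_sqDist_fst (r z ρ ϑ : ℝ) :
    HasDerivAt (fun ρ => sqDist r z ρ ϑ) (2 * (ρ - r * Real.cos ϑ)) ρ := by
  unfold sqDist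
  have h := ((((hasDerivAt_id ρ).pow 2).add_const (r ^ 2)).sub
    (((hasDerivAt_id ρ).const_mul 2).mul_const (r * Real.cos ϑ))).add_const (z ^ 2)
  refine (h.congr_deriv ?_).congr_of_eventuallyEq (Eventually.of_forall fun x => ?_)
  · simp; ring
  · simp; ring

lemma hasDerivAt_sqDist_snd (r z ρ ϑ : ℝ) :
    HasDerivAt (sqDist r z ρ) (2 * ρ * r * Real.sin ϑ) ϑ := by
  unfold sqDist
  have h := (((Real.hasDerivAt_cos ϑ).const_mul (2 * ρ * r)).const_sub (ρ ^ 2 + r ^ 2)).add_const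
    (z ^ 2)
  exact h.congr_deriv (by ring)

@[fun_prop]
lemma continuous_sqDist (r z : ℝ) : Continuous fun p : ℝ × ℝ => sqDist r z p.1 p.2 := by
  unfold sqDist; fun_prop

/-- The radial integral of the potential of a disk, in polar coordinates, as an integral over the
bounding circle. -/
lemma integral_polar_eq {z : ℝ} (hz : z ≠ 0) (r a : ℝ) :
    ∫ ρ in (0 : ℝ)..a, ∫ ϑ in (-Real.pi)..Real.pi, ρ / √(sqDist r z ρ ϑ) =
      ∫ ϑ in (-Real.pi)..Real.pi, a * (a - r * Real.cos ϑ) / (√(sqDist r z a ϑ) + |z|) := by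
  have hs : ∀ ρ ϑ, 0 < √(sqDist r z ρ ϑ) := fun ρ ϑ => Real.sqrt_pos.2 (sqDist_pos hz r ρ ϑ)
  have hz' : 0 < |z| := abs_pos.2 hz
  -- `A` is ρ times the radial component of u/(s + |z|) and `B` is its angular component, so `A' +
  -- B'` is ρ times the divergence. That divergence is 1/s because |u|² = s² - |z|².
  have key := integral_divergence_rectangle (t₀ := 0) (t₁ := a) (x₀ := -Real.pi) (x₁ := Real.pi)
    (A := fun ρ ϑ => ρ * (ρ - r * Real.cos ϑ) / (√(sqDist r z ρ ϑ) + |z|))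
    (A' := fun ρ ϑ => (2 * ρ - r * Real.cos ϑ) / (√(sqDist r z ρ ϑ) + |z|) -
      ρ * (ρ - r * Real.cos ϑ) ^ 2 / (√(sqDist r z ρ ϑ) * (√(sqDist r z ρ ϑ) + |z|) ^ 2))
    (B := fun ρ ϑ => r * Real.sin ϑ / (√(sqDist r z ρ ϑ) + |z|))
    (B' := fun ρ ϑ => r * Real.cos ϑ / (√(sqDist r z ρ ϑ) + |z|) -
      ρ * (r * Real.sin ϑ) ^ 2 / (√(sqDist r z ρ ϑ) * (√(sqDist r z ρ ϑ) + |z|) ^ 2))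
    ?_ ?_ ?_ ?_ ?_
  · simp only [zero_mul, zero_div, sub_zero] at key
    rw [← key]
    refine intervalIntegral.integral_congr fun ρ _ => ?_
    refine intervalIntegral.integral_congr fun ϑ _ => ?_
    have h1 := hs ρ ϑ
    have h2 : √(sqDist r z ρ ϑ) ^ 2 =
        (ρ - r * Real.cos ϑ) ^ 2 + (r * Real.sin ϑ) ^ 2 + |z| ^ 2 := by
      rw [Real.sq_sqrt (sqDist_nonneg r z ρ ϑ), sqDist_eq, sq_abs]
    generalize √(sqDist r z ρ ϑ) = s at *
    generalize |z| = ζ at *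
    have h3 : s + ζ ≠ 0 := by positivity
    field_simp
    linear_combination -ρ * h2
  · intro ρ _ ϑ _
    have h1 := hs ρ ϑ
    have hd := ((hasDerivAt_sqDist_fst r z ρ ϑ).sqrt (sqDist_pos hz r ρ ϑ).ne').add_const |z|
    have hn := (hasDerivAt_id ρ).mul ((hasDerivAt_id ρ).sub_const (r * Real.cos ϑ))
    refine (hn.div hd (by positivity)).congr_deriv ?_
    simp only [Pi.mul_apply, id]
    field_simp
    ring
  · intro ρ _ ϑ _
    have h1 := hs ρ ϑ
    have hd := ((hasDerivAt_sqDist_snd r z ρ ϑ).sqrt (sqDist_pos hz r ρ ϑ).ne').add_const |z|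
    have hn := (Real.hasDerivAt_sin ϑ).const_mul r
    refine (hn.div hd (by positivity)).congr_deriv ?_
    field_simp
  · unfold Function.uncurry
    refine Continuous.continuousOn (Continuous.sub (Continuous.div₀ ?_ ?_ ?_)
      (Continuous.div₀ ?_ ?_ ?_))
    all_goals first | fun_prop | skip
    · exact fun p => (add_pos (hs _ _) hz').ne'
    · exact fun p => (mul_pos (hs _ _) (pow_pos (add_pos (hs _ _) hz') 2)).ne'
  · unfold Function.uncurry
    refine Continuous.continuousOn (Continuous.sub (Continuous.div₀ ?_ ?_ ?_)
      (Continuous.div₀ ?_ ?_ ?_))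
    all_goals first | fun_prop | skip
    · exact fun p => (add_pos (hs _ _) hz').ne'
    · exact fun p => (mul_pos (hs _ _) (pow_pos (add_pos (hs _ _) hz') 2)).ne'
  · intro ρ _
    simp

lemma exists_radial_angle (P : EuclideanSpace ℝ (Fin 3)) :
    ∃ α, P 0 = radial P * Real.cos α ∧ P 1 = radial P * Real.sin α := by
  have h : radial P = ‖(⟨P 0, P 1⟩ : ℂ)‖ := by
    rw [radial, Complex.norm_eq_sqrt_sq_add_sq]
  refine ⟨Complex.arg ⟨P 0, P 1⟩, ?_, ?_⟩
  · rw [h, Complex.norm_mul_cos_arg]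
  · rw [h, Complex.norm_mul_sin_arg]

lemma radial_nonneg (P : EuclideanSpace ℝ (Fin 3)) : 0 ≤ radial P := Real.sqrt_nonneg _

lemma diskIntegral_eq_polar {a : ℝ} (ha : 0 < a) {P : EuclideanSpace ℝ (Fin 3)}
    (hz : height P ≠ 0) :
    diskIntegral a P = ∫ ρ in (0 : ℝ)..a, ∫ ϑ in (-Real.pi)..Real.pi,
      ρ / √(sqDist (radial P) (height P) ρ ϑ) := by
  obtain ⟨α, h0, h1⟩ := exists_radial_angle P
  have hcoord : ∀ ρ ϑ : ℝ, (P 0 - ρ * Real.cos ϑ) ^ 2 + (P 1 - ρ * Real.sin ϑ) ^ 2 + P 2 ^ 2 =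
      sqDist (radial P) (height P) ρ (ϑ - α) := by
    intro ρ ϑ
    rw [h0, h1, sqDist, Real.cos_sub, height]
    linear_combination ρ ^ 2 * Real.sin_sq_add_cos_sq ϑ + radial P ^ 2 * Real.sin_sq_add_cos_sq α
  set g : ℝ × ℝ → ℝ := fun p => p.1 / √(sqDist (radial P) (height P) p.1 (p.2 - α)) with hg
  have hgc : Continuous g := by
    refine continuous_fst.div ?_ fun p => (Real.sqrt_pos.2 (sqDist_pos hz _ _ _)).ne'
    have := continuous_sqDist (radial P) (height P)
    exact (this.comp (f := fun p : ℝ × ℝ => (p.1, p.2 - α)) (by fun_prop)).sqrt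
  set f : ℝ × ℝ → ℝ := {p : ℝ × ℝ | √(p.1 ^ 2 + p.2 ^ 2) ≤ a}.indicator
    fun p => 1 / √((P 0 - p.1) ^ 2 + (P 1 - p.2) ^ 2 + P 2 ^ 2) with hf
  have e1 : diskIntegral a P = ∫ p, f p := by
    rw [← integral_euclidean_two, diskIntegral,
      ← integral_indicator (isClosed_disk a).measurableSet]
    congr 1 with Q
    simp only [hf, Set.indicator, disk, Set.mem_ofPred_eq, EuclideanSpace.norm_eq,
      Fin.sum_univ_two, Real.norm_eq_abs, sq_abs, dist_planePoint]
  have e2 : ∀ p ∈ polarCoord.target, p.1 • f (polarCoord.symm p) =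
      {p : ℝ × ℝ | p.1 ≤ a}.indicator g p := by
    rintro ⟨ρ, ϑ⟩ hp
    have hρ : 0 < ρ := hp.1
    have hn : √((ρ * Real.cos ϑ) ^ 2 + (ρ * Real.sin ϑ) ^ 2) = ρ := by
      rw [show (ρ * Real.cos ϑ) ^ 2 + (ρ * Real.sin ϑ) ^ 2 = ρ ^ 2 by
        linear_combination ρ ^ 2 * Real.sin_sq_add_cos_sq ϑ]
      exact Real.sqrt_sq hρ.le
    simp only [polarCoord_symm_apply, hf, hg, Set.indicator, Set.mem_ofPred_eq, hn, hcoord,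
      smul_eq_mul]
    split_ifs <;> ring
  have hset : polarCoord.target ∩ {p : ℝ × ℝ | p.1 ≤ a} =
      Set.Ioc 0 a ×ˢ Set.Ioo (-Real.pi) Real.pi := by
    ext ⟨ρ, ϑ⟩
    simp only [polarCoord_target, Set.mem_inter_iff, Set.mem_prod, Set.mem_Ioi, Set.mem_ofPred_eq,
      Set.mem_Ioc]
    tauto
  have hint : IntegrableOn g (Set.Ioc 0 a ×ˢ Set.Ioo (-Real.pi) Real.pi)
      ((volume : Measure ℝ).prod volume) :=
    (hgc.continuousOn.integrableOn_compact
      ((isCompact_Icc (a := (0 : ℝ)) (b := a)).prod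
        (isCompact_Icc (a := -Real.pi) (b := Real.pi)))).mono_set
      (Set.prod_mono Set.Ioc_subset_Icc_self Set.Ioo_subset_Icc_self)
  rw [e1, ← integral_comp_polarCoord_symm,
    setIntegral_congr_fun polarCoord.open_target.measurableSet e2,
    setIntegral_indicator (measurableSet_le measurable_fst measurable_const), hset,
    Measure.volume_eq_prod, setIntegral_prod _ hint, intervalIntegral.integral_of_le ha.le]
  refine integral_congr_ae (Eventually.of_forall fun ρ => ?_)
  -- Periodicity removes the azimuth α of P from the full-circle integral.
  have hper : Function.Periodic (fun ϑ => ρ / √(sqDist (radial P) (height P) ρ ϑ))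
      (2 * Real.pi) := by
    intro ϑ
    simp [sqDist]
  have hrot := hper.intervalIntegral_add_eq (-Real.pi - α) (-Real.pi)
  rw [show -Real.pi - α + 2 * Real.pi = Real.pi - α by ring,
    show -Real.pi + 2 * Real.pi = Real.pi by ring] at hrot
  simp only [hg]
  rw [← integral_Ioc_eq_integral_Ioo,
    ← intervalIntegral.integral_of_le (by linarith [Real.pi_pos]),
    intervalIntegral.integral_comp_sub_right
      (fun ϑ => ρ / √(sqDist (radial P) (height P) ρ ϑ)) α, hrot]

/-- The integrand over the bounding circle that gives the potential of the disk. -/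
noncomputable def rimIntegrand (a r z ϑ : ℝ) : ℝ :=
  a * (a - r * Real.cos ϑ) / (√(sqDist r z a ϑ) + |z|)

lemma abs_sub_le_sqrt_sqDist (a r z ϑ : ℝ) : |a - r * Real.cos ϑ| ≤ √(sqDist r z a ϑ) := by
  refine Real.abs_le_sqrt ?_
  rw [sqDist_eq]
  nlinarith [sq_nonneg (r * Real.sin ϑ), sq_nonneg z]

/-- A bound uniform in z, which permits the passage to z = 0 under the integral even when the circle
passes through the projection of P. -/
lemma abs_rimIntegrand_le {a : ℝ} (ha : 0 < a) (r z ϑ : ℝ) : |rimIntegrand a r z ϑ| ≤ a := by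
  rw [rimIntegrand, abs_div, abs_mul, abs_of_pos ha,
    abs_of_nonneg (add_nonneg (Real.sqrt_nonneg _) (abs_nonneg z))]
  refine div_le_of_le_mul₀ (by positivity) ha.le ?_
  refine mul_le_mul_of_nonneg_left ?_ ha.le
  linarith [abs_sub_le_sqrt_sqDist a r z ϑ, abs_nonneg z]

lemma continuousAt_rimIntegrand (a r ϑ : ℝ) : ContinuousAt (fun z => rimIntegrand a r z ϑ) 0 := by
  unfold rimIntegrand
  -- The denominator can vanish at z = 0 only together with the numerator, and then the function is
  -- 0 for every z, with 0/0 = 0.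
  by_cases h : a - r * Real.cos ϑ = 0
  · simp only [h, mul_zero, zero_div]
    exact continuousAt_const
  · refine ContinuousAt.div continuousAt_const ?_ ?_
    · unfold sqDist; fun_prop
    · have := (abs_pos.2 h).trans_le (abs_sub_le_sqrt_sqDist a r 0 ϑ)
      positivity

lemma continuousAt_integral_rimIntegrand {a : ℝ} (ha : 0 < a) (r : ℝ) :
    ContinuousAt (fun z => ∫ ϑ in (-Real.pi)..Real.pi, rimIntegrand a r z ϑ) 0 := by
  refine intervalIntegral.continuousAt_of_dominated_interval (bound := fun _ => a)
    (Eventually.of_forall fun z => ?_) (Eventually.of_forall fun z => ?_) (by simp) ?_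
  · refine Measurable.aestronglyMeasurable ?_
    unfold rimIntegrand sqDist
    fun_prop
  · exact Eventually.of_forall fun ϑ _ => abs_rimIntegrand_le ha r z ϑ
  · exact Eventually.of_forall fun ϑ _ => continuousAt_rimIntegrand a r ϑ

/-- The point at height `z` above the projection of `P`. -/
noncomputable def atHeight (P : EuclideanSpace ℝ (Fin 3)) (z : ℝ) :
    EuclideanSpace ℝ (Fin 3) := !₂[P 0, P 1, z]

lemma continuous_atHeight (P : EuclideanSpace ℝ (Fin 3)) : Continuous (atHeight P) := by
  unfold atHeight
  refine (PiLp.continuous_toLp 2 _).comp (continuous_pi fun i => ?_)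
  fin_cases i <;> simp <;> fun_prop

lemma radial_atHeight (P : EuclideanSpace ℝ (Fin 3)) (z : ℝ) :
    radial (atHeight P z) = radial P := by simp [radial, atHeight]

lemma height_atHeight (P : EuclideanSpace ℝ (Fin 3)) (z : ℝ) : height (atHeight P z) = z := by
  simp [height, atHeight]

lemma atHeight_height (P : EuclideanSpace ℝ (Fin 3)) : atHeight P (height P) = P := by
  ext i; fin_cases i <;> simp [atHeight, height]

/-- The divergence argument covers z ≠ 0. At z = 0 both sides are limits along the vertical line
through P. -/
lemma diskIntegral_eq_rim {a : ℝ} (ha : 0 < a) (P : EuclideanSpace ℝ (Fin 3)) :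
    diskIntegral a P =
      ∫ ϑ in (-Real.pi)..Real.pi, rimIntegrand a (radial P) (height P) ϑ := by
  have off : ∀ Q : EuclideanSpace ℝ (Fin 3), height Q ≠ 0 → diskIntegral a Q =
      ∫ ϑ in (-Real.pi)..Real.pi, rimIntegrand a (radial Q) (height Q) ϑ := fun Q hQ => by
    rw [diskIntegral_eq_polar ha hQ, integral_polar_eq hQ]
    rfl
  by_cases hz : height P = 0
  · have l1 : Tendsto (fun z => diskIntegral a (atHeight P z)) (𝓝[≠] 0) (𝓝 (diskIntegral a P)) := by
      have := ((continuous_diskIntegral a).comp (continuous_atHeight P)).tendsto 0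
      rw [Function.comp_apply, ← hz, atHeight_height, hz] at this
      exact this.mono_left nhdsWithin_le_nhds
    have l2 := (continuousAt_integral_rimIntegrand ha (radial P)).tendsto.mono_left
      (nhdsWithin_le_nhds (s := {0}ᶜ))
    rw [hz]
    refine tendsto_nhds_unique l1 (l2.congr' ?_)
    filter_upwards [self_mem_nhdsWithin] with z hz
    rw [off _ (by rwa [height_atHeight]), radial_atHeight, height_atHeight]
  · exact off P hz

/-! ### The half-angle form and an elementary integral -/

/-- An integral over the circle of a function of the cosine, in terms of the half angle. -/
lemma integral_cos_eq_half_angle {h : ℝ → ℝ}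
    (hh : ∀ x y, IntervalIntegrable (fun ϑ => h (Real.cos ϑ)) volume x y) :
    ∫ ϑ in (-Real.pi)..Real.pi, h (Real.cos ϑ) =
      4 * ∫ θ in (0 : ℝ)..(Real.pi / 2), h (2 * Real.sin θ ^ 2 - 1) := by
  have e1 : ∫ ϑ in (-Real.pi)..0, h (Real.cos ϑ) = ∫ ϑ in (0 : ℝ)..Real.pi, h (Real.cos ϑ) := by
    have := intervalIntegral.integral_comp_neg (a := 0) (b := Real.pi) fun ϑ => h (Real.cos ϑ)
    simpa using this.symm
  rw [← intervalIntegral.integral_add_adjacent_intervals (hh _ 0)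
    (hh _ _), ← e1]
  -- The substitution is ϑ = 2θ - π, which makes the distance to the circle largest at θ = 0, as the
  -- modulus k requires.
  have e2 : ∫ θ in (0 : ℝ)..(Real.pi / 2), h (2 * Real.sin θ ^ 2 - 1) =
      ∫ θ in (0 : ℝ)..(Real.pi / 2), h (Real.cos (2 * θ - Real.pi)) := by
    refine intervalIntegral.integral_congr fun θ _ => ?_
    rw [Real.cos_sub_pi, Real.cos_two_mul, Real.cos_sq']
    ring_nf
  rw [e2, intervalIntegral.integral_comp_mul_sub (fun ϑ => h (Real.cos ϑ)) two_ne_zero]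
  rw [show 2 * (Real.pi / 2) - Real.pi = 0 by ring, show 2 * 0 - Real.pi = -Real.pi by ring]
  simp only [smul_eq_mul]
  ring

lemma intervalIntegrable_rimIntegrand {a : ℝ} (ha : 0 < a) (r z x y : ℝ) :
    IntervalIntegrable (rimIntegrand a r z) volume x y := by
  refine (intervalIntegrable_const (c := a)).mono_fun' ?_
    (Eventually.of_forall fun ϑ => abs_rimIntegrand_le ha r z ϑ)
  refine Measurable.aestronglyMeasurable ?_
  unfold rimIntegrand sqDist
  fun_prop

/-- The potential of the disk as a complete elliptic integral. -/
noncomputable def halfAngleIntegral (a r z : ℝ) : ℝ := ∫ θ in (0 : ℝ)..(Real.pi / 2),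
  4 * a * (a + r - 2 * r * Real.sin θ ^ 2) /
    (√((a + r) ^ 2 + z ^ 2 - 4 * a * r * Real.sin θ ^ 2) + |z|)

lemma diskIntegral_eq_halfAngleIntegral {a : ℝ} (ha : 0 < a) (P : EuclideanSpace ℝ (Fin 3)) :
    diskIntegral a P = halfAngleIntegral a (radial P) (height P) := by
  rw [diskIntegral_eq_rim ha, halfAngleIntegral]
  have := integral_cos_eq_half_angle (h := fun c => a * (a - radial P * c) /
    (√(a ^ 2 + radial P ^ 2 - 2 * a * radial P * c + height P ^ 2) + |height P|))
    (intervalIntegrable_rimIntegrand ha (radial P) (height P))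
  refine this.trans ?_
  rw [← intervalIntegral.integral_const_mul]
  refine intervalIntegral.integral_congr fun θ _ => ?_
  rw [show a ^ 2 + radial P ^ 2 - 2 * a * radial P * (2 * Real.sin θ ^ 2 - 1) + height P ^ 2 =
    (a + radial P) ^ 2 + height P ^ 2 - 4 * a * radial P * Real.sin θ ^ 2 by ring]
  ring

/-- The usual primitive arctan((B/A) tan x)/(AB) breaks down at π/2. Writing the arctangent as x
plus the arctangent of a bounded quotient, by the subtraction formula, gives a primitive smooth on
the whole line. -/
lemma integral_inv_cos_sq_add_sin_sq {A B : ℝ} (hA : 0 < A) (hB : 0 < B) :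
    ∫ x in (0 : ℝ)..(Real.pi / 2), 1 / (A ^ 2 * Real.cos x ^ 2 + B ^ 2 * Real.sin x ^ 2) =
      Real.pi / (2 * (A * B)) := by
  have h1 : ∀ x : ℝ, 0 < A * Real.cos x ^ 2 + B * Real.sin x ^ 2 := by
    intro x
    rcases le_total A B with h | h
    · nlinarith [Real.sin_sq_add_cos_sq x, sq_nonneg (Real.sin x)]
    · nlinarith [Real.sin_sq_add_cos_sq x, sq_nonneg (Real.cos x)]
  have h2 : ∀ x : ℝ, 0 < A ^ 2 * Real.cos x ^ 2 + B ^ 2 * Real.sin x ^ 2 := by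
    intro x
    rcases le_total (A ^ 2) (B ^ 2) with h | h
    · nlinarith [Real.sin_sq_add_cos_sq x, sq_nonneg (Real.sin x), pow_pos hA 2]
    · nlinarith [Real.sin_sq_add_cos_sq x, sq_nonneg (Real.cos x), pow_pos hB 2]
  have hd : ∀ x : ℝ, HasDerivAt (fun x => (x + Real.arctan ((B - A) * Real.sin x * Real.cos x /
      (A * Real.cos x ^ 2 + B * Real.sin x ^ 2))) / (A * B))
      (1 / (A ^ 2 * Real.cos x ^ 2 + B ^ 2 * Real.sin x ^ 2)) x := by
    intro x
    have hs := Real.hasDerivAt_sin x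
    have hc := Real.hasDerivAt_cos x
    have hn := (hs.const_mul (B - A)).mul hc
    have hq := ((hc.pow 2).const_mul A).add ((hs.pow 2).const_mul B)
    have hr := hn.div hq (h1 x).ne'
    refine (((hasDerivAt_id x).add hr.arctan).div_const (A * B)).congr_deriv ?_
    have g1 := (h1 x).ne'
    have g2 := (h2 x).ne'
    have hcs : Real.cos x ^ 2 = 1 - Real.sin x ^ 2 := Real.cos_sq' x
    have g3 : 1 + ((B - A) * Real.sin x * Real.cos x /
        (A * Real.cos x ^ 2 + B * Real.sin x ^ 2)) ^ 2 =
        (A ^ 2 * Real.cos x ^ 2 + B ^ 2 * Real.sin x ^ 2) /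
        (A * Real.cos x ^ 2 + B * Real.sin x ^ 2) ^ 2 := by
      field_simp
      linear_combination (A ^ 2 * Real.cos x ^ 2 + B ^ 2 * Real.sin x ^ 2) * hcs
    simp only [Pi.mul_apply, Pi.add_apply, Pi.pow_apply, Pi.div_apply]
    rw [g3]
    generalize Real.sin x = s at *
    generalize Real.cos x = c at *
    field_simp
    norm_num
    linear_combination ((B - A) * (A * c ^ 2 - B * s ^ 2) + A * B) * hcs
  rw [intervalIntegral.integral_eq_sub_of_hasDerivAt (fun x _ => hd x)]
  · simp
    field_simp
  · exact (continuous_const.div (by fun_prop) fun x => (h2 x).ne').intervalIntegrable _ _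

/-! ### Relations between p, q, k, k' and φ, and convergence of the integrals -/

section Moduli

variable {a r z : ℝ}

lemma longDist_sq_pos (ha : 0 < a) (hr : 0 ≤ r) (z : ℝ) : 0 < (a + r) ^ 2 + z ^ 2 := by
  positivity

lemma shortDist_sq_pos (h : r ≠ a ∨ z ≠ 0) : 0 < (a - r) ^ 2 + z ^ 2 := by
  rcases h with h | h
  · have : a - r ≠ 0 := sub_ne_zero.2 h.symm
    positivity
  · positivity

lemma modulus_sq (ha : 0 < a) (hr : 0 ≤ r) :
    modulus a r z ^ 2 = 4 * a * r / ((a + r) ^ 2 + z ^ 2) :=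
  Real.sq_sqrt (div_nonneg (by positivity) (longDist_sq_pos ha hr z).le)

lemma one_sub_modulus_sq (ha : 0 < a) (hr : 0 ≤ r) :
    1 - modulus a r z ^ 2 = ((a - r) ^ 2 + z ^ 2) / ((a + r) ^ 2 + z ^ 2) := by
  rw [modulus_sq ha hr]
  have := (longDist_sq_pos ha hr z).ne'
  field_simp
  ring

lemma modulus_sq_lt_one (ha : 0 < a) (hr : 0 ≤ r) (h : r ≠ a ∨ z ≠ 0) : modulus a r z ^ 2 < 1 := by
  have := one_sub_modulus_sq (z := z) ha hr
  have h2 := div_pos (shortDist_sq_pos h) (longDist_sq_pos ha hr z)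
  linarith

lemma coModulus_sq (ha : 0 < a) (hr : 0 ≤ r) : coModulus a r z ^ 2 = 1 - modulus a r z ^ 2 := by
  refine Real.sq_sqrt ?_
  rw [one_sub_modulus_sq ha hr]
  positivity

lemma pDist_pos (ha : 0 < a) (hr : 0 ≤ r) : 0 < pDist a r z :=
  Real.sqrt_pos.2 (longDist_sq_pos ha hr z)

lemma pDist_sq (a r z : ℝ) : pDist a r z ^ 2 = (a + r) ^ 2 + z ^ 2 := Real.sq_sqrt (by positivity)

lemma qDist_pos (h : r ≠ a ∨ z ≠ 0) : 0 < qDist a r z := Real.sqrt_pos.2 (shortDist_sq_pos h)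

lemma qDist_sq (a r z : ℝ) : qDist a r z ^ 2 = (a - r) ^ 2 + z ^ 2 := Real.sq_sqrt (by positivity)

lemma abs_le_qDist (a r z : ℝ) : |z| ≤ qDist a r z :=
  Real.abs_le_sqrt (by nlinarith [sq_nonneg (a - r)])

lemma height_ratio_le_one (a r z : ℝ) : |z| / qDist a r z ≤ 1 :=
  div_le_one_of_le₀ (abs_le_qDist a r z) (Real.sqrt_nonneg _)

lemma height_ratio_nonneg (a r z : ℝ) : 0 ≤ |z| / qDist a r z :=
  div_nonneg (abs_nonneg z) (Real.sqrt_nonneg _)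

lemma amplitude_nonneg (a r z : ℝ) : 0 ≤ amplitude a r z :=
  Real.arcsin_nonneg.2 (height_ratio_nonneg a r z)

lemma amplitude_le (a r z : ℝ) : amplitude a r z ≤ Real.pi / 2 := Real.arcsin_le_pi_div_two _

lemma sin_amplitude (a r z : ℝ) : Real.sin (amplitude a r z) = |z| / qDist a r z :=
  Real.sin_arcsin (by linarith [height_ratio_nonneg a r z]) (height_ratio_le_one a r z)

lemma cos_amplitude (h : r ≠ a ∨ z ≠ 0) : Real.cos (amplitude a r z) = |a - r| / qDist a r z := by
  have hq := qDist_pos h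
  rw [amplitude, Real.cos_arcsin]
  rw [show 1 - (|z| / qDist a r z) ^ 2 = ((a - r) / qDist a r z) ^ 2 by
    rw [div_pow, sq_abs, div_pow]
    have := qDist_sq a r z
    field_simp
    linarith, Real.sqrt_sq_eq_abs, abs_div, abs_of_pos hq]

lemma coModulus_sq_mul_sin_amplitude_sq (ha : 0 < a) (hr : 0 ≤ r) (h : r ≠ a ∨ z ≠ 0) :
    (1 - modulus a r z ^ 2) * Real.sin (amplitude a r z) ^ 2 = z ^ 2 / pDist a r z ^ 2 := by
  have hq := shortDist_sq_pos h
  have hp := longDist_sq_pos ha hr z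
  rw [one_sub_modulus_sq ha hr, sin_amplitude, div_pow, sq_abs, qDist_sq, pDist_sq]
  field_simp

lemma sqrt_eq_pDist_mul (ha : 0 < a) (hr : 0 ≤ r) (θ : ℝ) :
    √((a + r) ^ 2 + z ^ 2 - 4 * a * r * Real.sin θ ^ 2) =
      pDist a r z * √(1 - modulus a r z ^ 2 * Real.sin θ ^ 2) := by
  have hp := longDist_sq_pos ha hr z
  rw [pDist, ← Real.sqrt_mul hp.le, modulus_sq ha hr]
  congr 1
  field_simp

lemma continuous_one_div_sqrt {k : ℝ} (hk : k ^ 2 < 1) :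
    Continuous fun θ : ℝ => 1 / √(1 - k ^ 2 * Real.sin θ ^ 2) :=
  continuous_const.div (by fun_prop) fun _ => (Real.sqrt_pos.2 (one_sub_mul_sin_sq_pos hk)).ne'

lemma closedFormDefined_of_off_rim (ha : 0 < a) (hr : 0 ≤ r) (h : r ≠ a ∨ z ≠ 0) :
    ClosedFormDefined a r z where
  p_pos := pDist_pos ha hr
  q_pos := qDist_pos h
  ratio_le := height_ratio_le_one a r z
  arg_le := by rw [← modulus_sq ha hr]; exact (modulus_sq_lt_one ha hr h).le
  arg_nonneg := by positivity
  integrable_K := (continuous_one_div_sqrt (modulus_sq_lt_one ha hr h)).intervalIntegrable _ _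
  integrable_F := by
    refine ContinuousOn.intervalIntegrable ?_
    unfold firstKindIntegrand
    refine continuousOn_const.div (by fun_prop) fun θ hθ => (Real.sqrt_pos.2 ?_).ne'
    rw [Set.uIcc_of_le (amplitude_nonneg a r z)] at hθ
    have hpi := Real.pi_pos
    have h1 : Real.sin θ ≤ Real.sin (amplitude a r z) :=
      Real.sin_le_sin_of_le_of_le_pi_div_two (by linarith [hθ.1]) (amplitude_le a r z) hθ.2
    have h0 : 0 ≤ Real.sin θ := Real.sin_nonneg_of_nonneg_of_le_pi hθ.1
      (by linarith [hθ.2, amplitude_le a r z])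
    have h2 := mul_le_mul_of_nonneg_left (pow_le_pow_left₀ h0 h1 2)
      (sub_pos.2 (modulus_sq_lt_one ha hr h)).le
    rw [coModulus_sq_mul_sin_amplitude_sq ha hr h] at h2
    rw [coModulus_sq ha hr]
    -- Since k' sin φ = |z|/p < 1, the integrand of F stays bounded up to the amplitude, even on the
    -- axis, where k' = 1.
    have h3 : z ^ 2 / pDist a r z ^ 2 < 1 := by
      rw [pDist_sq, div_lt_one (longDist_sq_pos ha hr z)]
      have : 0 < a + r := by linarith
      nlinarith
    linarith

/-- The integral of the third kind diverges for parameter `1`. -/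
lemma not_intervalIntegrable_thirdKindIntegrand_one {k : ℝ} (hk : k ^ 2 < 1) :
    ¬ IntervalIntegrable (thirdKindIntegrand 1 k) volume 0 (Real.pi / 2) := by
  refine not_intervalIntegrable_of_sub_inv_isBigO_punctured (c := Real.pi / 2) ?_
    (by positivity) Set.right_mem_uIcc
  refine Asymptotics.IsBigO.of_bound 1 ?_
  have hb : Metric.ball (Real.pi / 2) 1 ∈ 𝓝[≠] (Real.pi / 2) :=
    nhdsWithin_le_nhds (Metric.ball_mem_nhds _ one_pos)
  filter_upwards [self_mem_nhdsWithin, hb] with x hx hx1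
  have hx0 : x - Real.pi / 2 ≠ 0 := sub_ne_zero.2 hx
  rw [Metric.mem_ball, Real.dist_eq] at hx1
  have hcos : Real.cos x = - Real.sin (x - Real.pi / 2) := by
    rw [Real.sin_sub_pi_div_two, neg_neg]
  have hsin : |Real.sin (x - Real.pi / 2)| ≤ |x - Real.pi / 2| := Real.abs_sin_le_abs
  have hne : Real.sin (x - Real.pi / 2) ≠ 0 := by
    intro h0
    rw [Real.sin_eq_zero_iff_of_lt_of_lt (by linarith [(abs_lt.1 hx1).1, Real.pi_gt_three])
      (by linarith [(abs_lt.1 hx1).2, Real.pi_gt_three])] at h0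
    exact hx0 h0
  have hδ : 0 < √(1 - k ^ 2 * Real.sin x ^ 2) := Real.sqrt_pos.2 (one_sub_mul_sin_sq_pos hk)
  have hδ1 : √(1 - k ^ 2 * Real.sin x ^ 2) ≤ 1 :=
    Real.sqrt_le_one.2 (by nlinarith [sq_nonneg (k * Real.sin x)])
  have hc2 : 1 - (1 : ℝ) ^ 2 * Real.sin x ^ 2 = |Real.sin (x - Real.pi / 2)| ^ 2 := by
    rw [sq_abs, ← neg_sq (Real.sin (x - _)), ← hcos, Real.cos_sq']; ring
  have hpos : 0 < |Real.sin (x - Real.pi / 2)| := abs_pos.2 hne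
  rw [one_mul, thirdKindIntegrand, hc2, norm_inv, Real.norm_eq_abs, Real.norm_eq_abs,
    abs_of_pos (one_div_pos.2 (mul_pos (pow_pos hpos 2) hδ)), one_div]
  -- Near π/2 the denominator is at most (x - π/2)², hence at most |x - π/2| within distance 1,
  -- which dominates a non-integrable singularity.
  refine inv_anti₀ (mul_pos (pow_pos hpos 2) hδ) ?_
  have h1 := mul_le_of_le_one_right (sq_nonneg |Real.sin (x - Real.pi / 2)|) hδ1
  nlinarith [abs_nonneg (x - Real.pi / 2)]

lemma thirdKindParam_self (ha : 0 < a) : thirdKindParam a a = 1 := by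
  rw [thirdKindParam, show 4 * a * a / (a + a) ^ 2 = 1 by field_simp; ring, Real.sqrt_one]

end Moduli

/-! ### Evaluation on the circle, above or below it, and elsewhere -/

lemma halfAngleIntegral_rim {a : ℝ} (ha : 0 < a) : halfAngleIntegral a a 0 = 4 * a := by
  have h : ∀ θ ∈ Set.uIcc 0 (Real.pi / 2), 4 * a * (a + a - 2 * a * Real.sin θ ^ 2) /
      (√((a + a) ^ 2 + 0 ^ 2 - 4 * a * a * Real.sin θ ^ 2) + |0|) = 4 * a * Real.cos θ := by
    intro θ hθ
    rw [Set.uIcc_of_le (by positivity)] at hθ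
    have hc : 0 ≤ Real.cos θ :=
      Real.cos_nonneg_of_mem_Icc ⟨by linarith [hθ.1, Real.pi_pos], hθ.2⟩
    have e : (a + a) ^ 2 + 0 ^ 2 - 4 * a * a * Real.sin θ ^ 2 = (2 * a * Real.cos θ) ^ 2 := by
      rw [mul_pow, Real.cos_sq']; ring
    rw [e, Real.sqrt_sq (by positivity), abs_zero, add_zero,
      show a + a - 2 * a * Real.sin θ ^ 2 = 2 * a * Real.cos θ ^ 2 by rw [Real.cos_sq']; ring]
    -- At θ = π/2 the quotient is 0/0 = 0, which agrees with 4a cos θ.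
    rcases hc.eq_or_lt with h0 | h0
    · simp [← h0]
    · field_simp
  rw [halfAngleIntegral, intervalIntegral.integral_congr h, intervalIntegral.integral_const_mul,
    integral_cos]
  simp

/-- For r = a the numerator is 2(s² - z²), so the quotient is 2(s - |z|) and only E(k) appears. -/
lemma halfAngleIntegral_above_rim {a z : ℝ} (ha : 0 < a) (hz : z ≠ 0) :
    halfAngleIntegral a a z = -2 * closedForm a a z := by
  have hz' : 0 < |z| := abs_pos.2 hz
  have h : ∀ θ ∈ Set.uIcc 0 (Real.pi / 2), 4 * a * (a + a - 2 * a * Real.sin θ ^ 2) /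
      (√((a + a) ^ 2 + z ^ 2 - 4 * a * a * Real.sin θ ^ 2) + |z|) =
      2 * pDist a a z * √(1 - modulus a a z ^ 2 * Real.sin θ ^ 2) - 2 * |z| := by
    intro θ _
    have e := sqrt_eq_pDist_mul (z := z) ha ha.le θ
    have hs : √((a + a) ^ 2 + z ^ 2 - 4 * a * a * Real.sin θ ^ 2) ^ 2 =
        (a + a) ^ 2 + z ^ 2 - 4 * a * a * Real.sin θ ^ 2 := Real.sq_sqrt (by
      nlinarith [mul_nonneg (sq_nonneg a) (sub_nonneg.2 (Real.sin_sq_le_one θ)), sq_nonneg z])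
    rw [mul_assoc 2 (pDist a a z), ← e, div_eq_iff (by positivity)]
    linear_combination -2 * hs + 2 * sq_abs z
  rw [halfAngleIntegral, intervalIntegral.integral_congr h, intervalIntegral.integral_sub
    (Continuous.intervalIntegrable (by fun_prop) _ _) (by simp),
    intervalIntegral.integral_const_mul, intervalIntegral.integral_const]
  simp only [closedForm, ellipticE, ellipticEInc, sub_self, Real.sign_zero, smul_eq_mul]
  ring

/-- Let R = s² - z² be the squared distance within the plane. The numerator is 2R + 2(a² - r²), and
1/(s + |z|) = (s - |z|)/R; then s/R = 1/s + z²/(Rs) isolates the third kind. -/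
lemma halfAngle_integrand_split {a r z : ℝ} (ha : 0 < a) (hr : 0 ≤ r) (h : r ≠ a) (θ : ℝ) :
    4 * a * (a + r - 2 * r * Real.sin θ ^ 2) /
      (√((a + r) ^ 2 + z ^ 2 - 4 * a * r * Real.sin θ ^ 2) + |z|) =
    (2 * pDist a r z * √(1 - modulus a r z ^ 2 * Real.sin θ ^ 2) +
      2 * (a ^ 2 - r ^ 2) / pDist a r z * (1 / √(1 - modulus a r z ^ 2 * Real.sin θ ^ 2)) +
      2 * z ^ 2 * (a ^ 2 - r ^ 2) / pDist a r z *
        (1 / (((a + r) ^ 2 * Real.cos θ ^ 2 + |a - r| ^ 2 * Real.sin θ ^ 2) *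
          √(1 - modulus a r z ^ 2 * Real.sin θ ^ 2)))) -
    2 * |z| * (a ^ 2 - r ^ 2) *
      (1 / ((a + r) ^ 2 * Real.cos θ ^ 2 + |a - r| ^ 2 * Real.sin θ ^ 2)) - 2 * |z| := by
  have hp := pDist_pos (z := z) ha hr
  have hk := modulus_sq_lt_one (z := z) ha hr (Or.inl h)
  have hδ : 0 < √(1 - modulus a r z ^ 2 * Real.sin θ ^ 2) :=
    Real.sqrt_pos.2 (one_sub_mul_sin_sq_pos hk)
  have hρ : 0 < (a + r) ^ 2 * Real.cos θ ^ 2 + |a - r| ^ 2 * Real.sin θ ^ 2 := by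
    have h1 : 0 < |a - r| ^ 2 := pow_pos (abs_pos.2 (sub_ne_zero.2 h.symm)) 2
    have h2 : |a - r| ^ 2 ≤ (a + r) ^ 2 := by rw [sq_abs]; nlinarith
    nlinarith [Real.sin_sq_add_cos_sq θ, sq_nonneg (Real.cos θ)]
  have hs2 : (pDist a r z * √(1 - modulus a r z ^ 2 * Real.sin θ ^ 2)) ^ 2 =
      (a + r) ^ 2 * Real.cos θ ^ 2 + |a - r| ^ 2 * Real.sin θ ^ 2 + |z| ^ 2 := by
    rw [mul_pow, Real.sq_sqrt (one_sub_mul_sin_sq_pos hk).le, pDist_sq, modulus_sq ha hr, sq_abs,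
      sq_abs, Real.cos_sq']
    have := (longDist_sq_pos ha hr z).ne'
    field_simp
    ring
  have hnum : 4 * a * (a + r - 2 * r * Real.sin θ ^ 2) =
      2 * ((a + r) ^ 2 * Real.cos θ ^ 2 + |a - r| ^ 2 * Real.sin θ ^ 2) + 2 * (a ^ 2 - r ^ 2) := by
    rw [sq_abs, Real.cos_sq']; ring
  rw [sqrt_eq_pDist_mul ha hr, hnum, ← sq_abs z]
  have hz := abs_nonneg z
  generalize (a + r) ^ 2 * Real.cos θ ^ 2 + |a - r| ^ 2 * Real.sin θ ^ 2 = R at *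
  generalize √(1 - modulus a r z ^ 2 * Real.sin θ ^ 2) = δ at *
  generalize pDist a r z = p at *
  generalize |z| = ζ at *
  have hR : R = (p * δ) ^ 2 - ζ ^ 2 := by linarith
  have h3 : p * δ + ζ ≠ 0 := by positivity
  rw [div_eq_iff h3]
  field_simp
  subst hR
  ring

lemma heuman_eq_thirdKind {a r z : ℝ} (ha : 0 < a) (hr : 0 ≤ r) (h : r ≠ a) :
    ellipticE (modulus a r z) * ellipticF (amplitude a r z) (coModulus a r z) +
      ellipticK (modulus a r z) * ellipticEInc (amplitude a r z) (coModulus a r z) -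
      ellipticK (modulus a r z) * ellipticF (amplitude a r z) (coModulus a r z) =
    |z| * |a - r| * (a + r) / pDist a r z * ∫ θ in (0 : ℝ)..(Real.pi / 2),
      1 / (((a + r) ^ 2 * Real.cos θ ^ 2 + |a - r| ^ 2 * Real.sin θ ^ 2) *
          √(1 - modulus a r z ^ 2 * Real.sin θ ^ 2)) := by
  have hor : r ≠ a ∨ z ≠ 0 := Or.inl h
  have hp := pDist_pos (z := z) ha hr
  have hq := qDist_pos hor
  have hp2 := pDist_sq a r z
  -- The amplitude reaches π/2 only for r = a, since cos φ = |a - r|/q.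
  have hφ : amplitude a r z < Real.pi / 2 := by
    refine lt_of_le_of_ne (amplitude_le a r z) fun he => ?_
    have hc := cos_amplitude hor
    rw [he, Real.cos_pi_div_two] at hc
    have : 0 < |a - r| / qDist a r z := div_pos (abs_pos.2 (sub_ne_zero.2 h.symm)) hq
    linarith
  rw [heuman_eq (coModulus_sq ha hr) (modulus_sq_lt_one ha hr hor) (amplitude_nonneg a r z) hφ,
    coModulus_sq_mul_sin_amplitude_sq ha hr hor, one_sub_modulus_sq ha hr, sin_amplitude,
    cos_amplitude hor, ← pDist_sq, ← qDist_sq]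
  have e1 : √(1 - z ^ 2 / pDist a r z ^ 2) = (a + r) / pDist a r z := by
    rw [show 1 - z ^ 2 / pDist a r z ^ 2 = ((a + r) / pDist a r z) ^ 2 by
      field_simp; linarith, Real.sqrt_sq (by positivity)]
  have e2 : ∀ θ ∈ Set.uIcc 0 (Real.pi / 2),
      1 / ((1 - z ^ 2 / pDist a r z ^ 2 - modulus a r z ^ 2 * Real.sin θ ^ 2) *
        √(1 - modulus a r z ^ 2 * Real.sin θ ^ 2)) =
      pDist a r z ^ 2 * (1 / (((a + r) ^ 2 * Real.cos θ ^ 2 + |a - r| ^ 2 * Real.sin θ ^ 2) *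
          √(1 - modulus a r z ^ 2 * Real.sin θ ^ 2))) := by
    intro θ _
    have e3 : 1 - z ^ 2 / pDist a r z ^ 2 - modulus a r z ^ 2 * Real.sin θ ^ 2 =
        ((a + r) ^ 2 * Real.cos θ ^ 2 + |a - r| ^ 2 * Real.sin θ ^ 2) / pDist a r z ^ 2 := by
      rw [modulus_sq ha hr, sq_abs, Real.cos_sq', ← hp2]
      field_simp
      rw [hp2]
      ring
    rw [e3, div_mul_eq_mul_div, one_div_div, mul_one_div]
  rw [e1, intervalIntegral.integral_congr e2, intervalIntegral.integral_const_mul]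
  generalize (∫ θ in (0 : ℝ)..(Real.pi / 2), 1 / (((a + r) ^ 2 * Real.cos θ ^ 2 +
      |a - r| ^ 2 * Real.sin θ ^ 2) * √(1 - modulus a r z ^ 2 * Real.sin θ ^ 2))) = J
  field_simp

lemma halfAngleIntegral_of_ne {a r z : ℝ} (ha : 0 < a) (hr : 0 ≤ r) (h : r ≠ a) :
    halfAngleIntegral a r z = -2 * closedForm a r z := by
  have hp := pDist_pos (z := z) ha hr
  have hk := modulus_sq_lt_one (z := z) ha hr (Or.inl h)
  have hB : 0 < |a - r| := abs_pos.2 (sub_ne_zero.2 h.symm)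
  have hA : 0 < a + r := by linarith
  have hδ : ∀ θ : ℝ, 0 < √(1 - modulus a r z ^ 2 * Real.sin θ ^ 2) := fun θ =>
    Real.sqrt_pos.2 (one_sub_mul_sin_sq_pos hk)
  have hρ : ∀ θ : ℝ, 0 < (a + r) ^ 2 * Real.cos θ ^ 2 + |a - r| ^ 2 * Real.sin θ ^ 2 := by
    intro θ
    have h2 : |a - r| ^ 2 ≤ (a + r) ^ 2 := by rw [sq_abs]; nlinarith
    nlinarith [Real.sin_sq_add_cos_sq θ, sq_nonneg (Real.cos θ), pow_pos hB 2]
  have i1 : IntervalIntegrable (fun θ => √(1 - modulus a r z ^ 2 * Real.sin θ ^ 2)) volume 0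
      (Real.pi / 2) := Continuous.intervalIntegrable (by fun_prop) _ _
  have i2 := (continuous_one_div_sqrt hk).intervalIntegrable (μ := volume) 0 (Real.pi / 2)
  have i3 : IntervalIntegrable (fun θ => 1 / (((a + r) ^ 2 * Real.cos θ ^ 2 +
      |a - r| ^ 2 * Real.sin θ ^ 2) * √(1 - modulus a r z ^ 2 * Real.sin θ ^ 2))) volume 0
      (Real.pi / 2) :=
    (continuous_const.div (by fun_prop) fun θ => (mul_pos (hρ θ) (hδ θ)).ne').intervalIntegrable _ _
  have i4 : IntervalIntegrable (fun θ => 1 / ((a + r) ^ 2 * Real.cos θ ^ 2 +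
      |a - r| ^ 2 * Real.sin θ ^ 2)) volume 0 (Real.pi / 2) :=
    (continuous_const.div (by fun_prop) fun θ => (hρ θ).ne').intervalIntegrable _ _
  have j12 := (i1.const_mul (2 * pDist a r z)).add
    (i2.const_mul (2 * (a ^ 2 - r ^ 2) / pDist a r z))
  have j3 := i3.const_mul (2 * z ^ 2 * (a ^ 2 - r ^ 2) / pDist a r z)
  have j4 := i4.const_mul (2 * |z| * (a ^ 2 - r ^ 2))
  rw [halfAngleIntegral,
    intervalIntegral.integral_congr fun θ _ => halfAngle_integrand_split (z := z) ha hr h θ,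
    intervalIntegral.integral_sub ((j12.add j3).sub j4) (by simp),
    intervalIntegral.integral_sub (j12.add j3) j4, intervalIntegral.integral_add j12 j3,
    intervalIntegral.integral_add (i1.const_mul _) (i2.const_mul _)]
  simp only [intervalIntegral.integral_const_mul, intervalIntegral.integral_const, smul_eq_mul]
  rw [integral_inv_cos_sq_add_sin_sq hA hB, closedForm, heuman_eq_thirdKind ha hr h]
  simp only [ellipticE, ellipticEInc, ellipticK, ellipticF, firstKindIntegrand]
  generalize (∫ θ in (0 : ℝ)..(Real.pi / 2), 1 / (((a + r) ^ 2 * Real.cos θ ^ 2 +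
      |a - r| ^ 2 * Real.sin θ ^ 2) * √(1 - modulus a r z ^ 2 * Real.sin θ ^ 2))) = J
  rw [← sq_abs z]
  -- Replacing (a² - r²)/((a + r)|a - r|) by sign(a - r) matches both the elementary term and the
  -- Heuman term.
  rcases lt_or_gt_of_ne h with h' | h'
  · have h0 : 0 < a - r := sub_pos.2 h'
    rw [Real.sign_of_pos h0, abs_of_pos h0]
    field_simp
    ring
  · have h0 : a - r < 0 := sub_neg.2 h'
    have h1 : -(a - r) ≠ 0 := by linarith
    rw [Real.sign_of_neg h0, abs_of_neg h0]
    field_simp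
    ring

lemma diskIntegral_eq_closedForm {a : ℝ} (ha : 0 < a) {P : EuclideanSpace ℝ (Fin 3)}
    (hP : P ∉ rim a) : diskIntegral a P = -2 * closedForm a (radial P) (height P) := by
  rw [diskIntegral_eq_halfAngleIntegral ha]
  by_cases h : radial P = a
  · rw [h]
    exact halfAngleIntegral_above_rim ha fun hz => hP ⟨h, hz⟩
  · exact halfAngleIntegral_of_ne ha (radial_nonneg P) h

lemma diskIntegral_of_mem_rim {a : ℝ} (ha : 0 < a) {P : EuclideanSpace ℝ (Fin 3)}
    (hP : P ∈ rim a) : diskIntegral a P = 4 * a := by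
  rw [diskIntegral_eq_halfAngleIntegral ha, hP.1, hP.2, halfAngleIntegral_rim ha]

/-! ### From the disk integral to the potentials of disk and annulus -/

lemma planarPotential_disk (G σ a : ℝ) (P : EuclideanSpace ℝ (Fin 3)) :
    planarPotential G σ (disk a) P = -G * σ * diskIntegral a P := by
  simp only [planarPotential, diskIntegral, div_eq_mul_one_div σ, integral_const_mul]
  ring

lemma annulus_ae_eq {a b : ℝ} :
    (annulus a b : Set (EuclideanSpace ℝ (Fin 2))) =ᵐ[volume] (disk a \ disk b : Set _) := by
  have hs : ∀ᵐ u : EuclideanSpace ℝ (Fin 2), u ∉ Metric.sphere 0 b :=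
    compl_mem_ae_iff.2 (Measure.addHaar_sphere _ _ _)
  filter_upwards [hs] with u hu
  have hu' : b ≠ ‖u‖ := by simpa [eq_comm] using hu
  refine propext ?_
  change (b ≤ ‖u‖ ∧ ‖u‖ ≤ a) ↔ (‖u‖ ≤ a ∧ ¬ ‖u‖ ≤ b)
  rw [not_le, and_comm, le_iff_lt_or_eq (a := b)]
  tauto

lemma planarPotential_annulus (G σ : ℝ) {a b : ℝ} (hab : b < a) (P : EuclideanSpace ℝ (Fin 3)) :
    planarPotential G σ (annulus a b) P =
      planarPotential G σ (disk a) P - planarPotential G σ (disk b) P := by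
  have hsub : disk b ⊆ disk a := fun u hu => le_trans hu hab.le
  have hint : IntegrableOn (fun Q => σ / dist P (planePoint Q)) (disk a) := by
    simp only [div_eq_mul_one_div σ]
    exact (potentialFinite_disk a P).const_mul σ
  rw [planarPotential, planarPotential, planarPotential, setIntegral_congr_set annulus_ae_eq,
    setIntegral_sdiff (isClosed_disk b).measurableSet hint hsub]
  ring

lemma potentialFinite_annulus (a b : ℝ) (P : EuclideanSpace ℝ (Fin 3)) :
    PotentialFinite (annulus a b) P :=
  (potentialFinite_disk a P).mono_set fun _ hu => hu.2

end DiskPotential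

theorem mainTheorem2 (G M : ℝ) :
    (∀ a : ℝ, 0 < a → ∀ P : EuclideanSpace ℝ (Fin 3),
      PotentialFinite (disk a) P ∧
      (P ∉ rim a →
        ClosedFormDefined a (radial P) (height P) ∧
        diskPotential G M a P =
          2 * G * M / (Real.pi * a ^ 2) * closedForm a (radial P) (height P)) ∧
      (P ∈ rim a →
        diskPotential G M a P = -4 * G * M / (Real.pi * a) ∧
        Tendsto
          (fun P' => 2 * G * M / (Real.pi * a ^ 2) * closedForm a (radial P') (height P'))
          (𝓝[(rim a)ᶜ] P) (𝓝 (diskPotential G M a P))) ∧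
      (radial P = a → height P ≠ 0 →
        ¬ IntervalIntegrable
          (thirdKindIntegrand (thirdKindParam a (radial P)) (modulus a (radial P) (height P)))
          volume 0 (Real.pi / 2))) ∧
    (∀ a b : ℝ, 0 < b → b < a → ∀ P : EuclideanSpace ℝ (Fin 3),
      PotentialFinite (annulus a b) P ∧
      annulusPotential G M a b P =
        planarPotential G (M / (Real.pi * (a ^ 2 - b ^ 2))) (disk a) P
          - planarPotential G (M / (Real.pi * (a ^ 2 - b ^ 2))) (disk b) P ∧
      (P ∉ rim a ∪ rim b →
        annulusPotential G M a b P =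
          2 * G * M / (Real.pi * (a ^ 2 - b ^ 2)) *
            (closedForm a (radial P) (height P) - closedForm b (radial P) (height P))) ∧
      (P ∈ rim a ∪ rim b →
        Tendsto
          (fun P' => 2 * G * M / (Real.pi * (a ^ 2 - b ^ 2)) *
            (closedForm a (radial P') (height P') - closedForm b (radial P') (height P')))
          (𝓝[(rim a ∪ rim b)ᶜ] P) (𝓝 (annulusPotential G M a b P)))) := by 
  refine ⟨fun a ha P => ⟨potentialFinite_disk a P, fun hP => ⟨?_, ?_⟩, fun hP => ⟨?_, ?_⟩, ?_⟩,
    fun a b hb hab P => ⟨potentialFinite_annulus a b P, planarPotential_annulus G _ hab P,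
      fun hP => ?_, fun hP => ?_⟩⟩
  · refine closedFormDefined_of_off_rim ha (radial_nonneg P) ?_
    by_contra! h
    exact hP h
  · rw [diskPotential, planarPotential_disk, diskIntegral_eq_closedForm ha hP]
    ring
  · rw [diskPotential, planarPotential_disk, diskIntegral_of_mem_rim ha hP]
    field_simp
  · have hc : Continuous (diskPotential G M a) := by
      rw [show diskPotential G M a = fun P => -G * (M / (Real.pi * a ^ 2)) * diskIntegral a P from
        funext fun P => planarPotential_disk G _ a P]
      exact continuous_const.mul (continuous_diskIntegral a)
    refine (hc.continuousAt.tendsto.mono_left nhdsWithin_le_nhds).congr' ?_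
    filter_upwards [self_mem_nhdsWithin] with P' hP'
    rw [diskPotential, planarPotential_disk, diskIntegral_eq_closedForm ha hP']
    ring
  · intro hr hz
    rw [hr, thirdKindParam_self ha]
    exact not_intervalIntegrable_thirdKindIntegrand_one (modulus_sq_lt_one ha ha.le (Or.inr hz))
  · rw [Set.mem_union, not_or] at hP
    rw [annulusPotential, planarPotential_annulus G _ hab, planarPotential_disk,
      planarPotential_disk, diskIntegral_eq_closedForm (hb.trans hab) hP.1,
      diskIntegral_eq_closedForm hb hP.2]
    ring
  · have e : annulusPotential G M a b = fun P =>
        -G * (M / (Real.pi * (a ^ 2 - b ^ 2))) * diskIntegral a P -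
          -G * (M / (Real.pi * (a ^ 2 - b ^ 2))) * diskIntegral b P := by
      funext P
      rw [annulusPotential, planarPotential_annulus G _ hab, planarPotential_disk,
        planarPotential_disk]
    have hc : Continuous (annulusPotential G M a b) := by
      rw [e]
      exact (continuous_const.mul (continuous_diskIntegral a)).sub
        (continuous_const.mul (continuous_diskIntegral b))
    refine (hc.continuousAt.tendsto.mono_left nhdsWithin_le_nhds).congr' ?_
    filter_upwards [self_mem_nhdsWithin] with P' hP'
    rw [Set.mem_compl_iff, Set.mem_union, not_or] at hP'
    rw [e]
    simp only
    rw [diskIntegral_eq_closedForm (hb.trans hab) hP'.1, diskIntegral_eq_closedForm hb hP'.2]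
    ring
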